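/- Fix $p\in(0,1)$. For integers $d,n,m$, let $(\mathbf x_u)_{u\in R}$, $|R|=n$, and $(\mathbf x_v)_{v\in L}$, $|L|=m$, be independent standard Gaussian vectors in $\mathbb R^d$, let $\tau=\tau(d,p)$ be the threshold with $\Pr[d^{-1/2}\langle \mathbf x_u,\mathbf x_v\rangle\le\tau]=p$ for $u\in R$, $v\in L$, and let $\sigma(\langle \mathbf x_u,\mathbf x_v\rangle)$ be the indicator of the event $d^{-1/2}\langle \mathbf x_u,\mathbf x_v\rangle\le\tau$. For a subgraph $\alpha$ of the complete bipartite graph $K_{n,m}$ with parts $R$ and $L$, identified with its set of edges and with $|\alpha|$ denoting the number of its edges, define the signed weight $$\mathrm{SW}(\alpha)=\prod_{\{u,v\}\in\alpha}\bigl(\sigma(\langle \mathbf x_u,\mathbf x_v\rangle)-p\bigr).$$ Then there is a constant $C>0$, depending only on $p$, such that for all $d\ge 2$, all $n,m$ and every $\alpha\subseteq K_{n,m}$, $$\mathbb E\bigl[\mathrm{SW}(\alpha)\bigr]\le\left(\frac{C\,|\alpha|^{3/2}\log(d)^{1/2}}{\sqrt d}\right)^{|\alpha|/2},$$ where the expectation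 is over all latent vectors, and for $\alpha=\emptyset$ the right-hand side is read as $1$. -/

import Mathlib

open MeasureTheory ProbabilityTheory Set Filter Topology

namespace BipartiteRGG

/-- The space `ℝ^d` of latent vectors, with its Euclidean inner product. -/
abbrev Vec (d : ℕ) : Type := EuclideanSpace ℝ (Fin d)

/-- The law of `d^{-1/2} ⟨x, y⟩` for independent `x, y ∼ N(0, I_d)`. -/
noncomputable def innerLaw (d : ℕ) : Measure ℝ :=
  ((stdGaussian (Vec d)).prod (stdGaussian (Vec d))).map
    (fun z => (inner ℝ z.1 z.2 : ℝ) / Real.sqrt d)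

/-- The connection threshold `τ = τ(d, p)`: the `p`-quantile of `d^{-1/2} ⟨x, y⟩`. By
`innerLaw_Iic_threshold` it satisfies `P(d^{-1/2} ⟨x, y⟩ ≤ τ) = p` for `d ≥ 1` and `0 < p < 1`. -/
noncomputable def threshold (d : ℕ) (p : ℝ) : ℝ :=
  sInf {t : ℝ | p ≤ (innerLaw d).real (Iic t)}

open Classical in
/-- The indicator `σ(⟨x, y⟩)` of the event `d^{-1/2} ⟨x, y⟩ ≤ τ(d, p)`. -/
noncomputable def edgeIndicator (d : ℕ) (p : ℝ) (x y : Vec d) : ℝ :=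
  if (inner ℝ x y : ℝ) / Real.sqrt d ≤ threshold d p then 1 else 0

/-- The signed weight `∏_{{u,v} ∈ α} (σ(⟨x_u, x_v⟩) - p)` of a subgraph `α` of `K_{n,m}`. Such a
subgraph is represented by its set of edges, and the edge joining the vertex `u` of the part
`R = [n]` to the vertex `v` of the part `L = [m]` is the pair `(u, v)`. -/
noncomputable def signedWeight {d n m : ℕ} (p : ℝ) (α : Finset (Fin n × Fin m))
    (XR : Fin n → Vec d) (XL : Fin m → Vec d) : ℝ :=
  ∏ e ∈ α, (edgeIndicator d p (XR e.1) (XL e.2) - p)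

/-- The joint law of the latent vectors `(X_R, X_L)`: all are independent `N(0, I_d)`. -/
noncomputable def latentLaw (d n m : ℕ) : Measure ((Fin n → Vec d) × (Fin m → Vec d)) :=
  (Measure.pi fun _ : Fin n => stdGaussian (Vec d)).prod
    (Measure.pi fun _ : Fin m => stdGaussian (Vec d))

/-- The unconditional expected signed weight `E_{X_L, X_R}[SW(α)]`. -/
noncomputable def expectedSignedWeight (d : ℕ) (p : ℝ) {n m : ℕ}
    (α : Finset (Fin n × Fin m)) : ℝ :=
  ∫ X, signedWeight p α X.1 X.2 ∂(latentLaw d n m)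

instance isProbabilityMeasure_innerLaw (d : ℕ) : IsProbabilityMeasure (innerLaw d) :=
  Measure.isProbabilityMeasure_map (by fun_prop)

theorem stdGaussian_hyperplane {d : ℕ} {y : Vec d} (hy : y ≠ 0) (c : ℝ) :
    stdGaussian (Vec d) {x | (inner ℝ y x : ℝ) = c} = 0 := by
  have h := IsGaussian.map_eq_gaussianReal (μ := stdGaussian (Vec d)) (innerSL ℝ y)
  have hv : (Var[innerSL ℝ y; stdGaussian (Vec d)]).toNNReal ≠ 0 := by
    rw [variance_dual_stdGaussian, innerSL_apply_norm]
    have : 0 < ‖y‖ ^ 2 := by positivity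
    simpa using hy
  have := nullSingletonClass_gaussianReal (μ := (stdGaussian (Vec d))[innerSL ℝ y]) hv
  have h0 : ((stdGaussian (Vec d)).map (innerSL ℝ y)) {c} = 0 := by
    rw [h]; exact measure_singleton c
  rw [Measure.map_apply (by fun_prop) (measurableSet_singleton c)] at h0
  exact h0

theorem innerLaw_singleton {d : ℕ} (hd : 1 ≤ d) (t : ℝ) : innerLaw d {t} = 0 := by
  have hsd : Real.sqrt d ≠ 0 := by positivity
  have hm : Measurable (fun z : Vec d × Vec d => (inner ℝ z.1 z.2 : ℝ) / Real.sqrt d) := by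
    fun_prop
  have h0 : stdGaussian (Vec d) {0} = 0 := by
    let e : Vec d := EuclideanSpace.single ⟨0, hd⟩ 1
    have he : e ≠ 0 := by simp [e]
    refine measure_mono_null ?_ (stdGaussian_hyperplane he 0)
    intro x hx
    simp_all
  rw [innerLaw, Measure.map_apply hm (measurableSet_singleton t),
    Measure.measure_prod_null (hm (measurableSet_singleton t))]
  have hae : ∀ᵐ y ∂(stdGaussian (Vec d)), y ≠ 0 := by
    rw [ae_iff]; simpa using h0
  filter_upwards [hae] with y hy
  refine measure_mono_null ?_ (stdGaussian_hyperplane hy (t * Real.sqrt d))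
  intro x hx
  have hx' : (inner ℝ y x : ℝ) / Real.sqrt d = t := hx
  change (inner ℝ y x : ℝ) = t * Real.sqrt d
  rw [← hx']
  field_simp

/-- The threshold has the property that defines it. -/
theorem innerLaw_Iic_threshold {d : ℕ} (hd : 1 ≤ d) {p : ℝ} (hp0 : 0 < p) (hp1 : p < 1) :
    (innerLaw d).real (Iic (threshold d p)) = p := by
  set F := cdf (innerLaw d) with hF
  set S : Set ℝ := {t : ℝ | p ≤ (innerLaw d).real (Iic t)} with hS
  have hSF : ∀ t, t ∈ S ↔ p ≤ F t := fun t => by rw [hS, hF, cdf_eq_real]; rfl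
  obtain ⟨b, hb⟩ := ((tendsto_cdf_atTop (innerLaw d)).eventually (lt_mem_nhds hp1)).exists
  obtain ⟨a, ha⟩ := ((tendsto_cdf_atBot (innerLaw d)).eventually (gt_mem_nhds hp0)).exists
  have hne : S.Nonempty := ⟨b, (hSF b).2 hb.le⟩
  have hbdd : BddBelow S := ⟨a, fun t ht => by
    by_contra hlt
    have := monotone_cdf (innerLaw d) (not_le.1 hlt).le
    have := (hSF t).1 ht
    linarith⟩
  have hτ : threshold d p = sInf S := rfl
  rw [← cdf_eq_real, ← hF]
  apply le_antisymm
  · have hs : F.measure {threshold d p} = 0 := by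
      rw [hF, measure_cdf]; exact innerLaw_singleton hd _
    rw [StieltjesFunction.measure_singleton, ENNReal.ofReal_eq_zero] at hs
    have hl : Function.leftLim F (threshold d p) ≤ p := by
      refine le_of_tendsto (F.mono.tendsto_leftLim (threshold d p)) ?_
      filter_upwards [self_mem_nhdsWithin] with t ht
      by_contra hlt
      have hmem : t ∈ S := (hSF t).2 (not_le.1 hlt).le
      have := csInf_le hbdd hmem
      rw [← hτ] at this
      exact absurd ht (not_lt.2 this)
    linarith
  · refine ge_of_tendsto ((F.right_continuous (threshold d p)).mono Ioi_subset_Ici_self) ?_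
    filter_upwards [self_mem_nhdsWithin] with t ht
    obtain ⟨s, hs, hst⟩ := exists_lt_of_csInf_lt hne (show sInf S < t from ht)
    exact ((hSF s).1 hs).trans (F.mono hst.le)

end BipartiteRGG

namespace BipartiteRGG

section StandardNormal

/-- The standard normal distribution function. -/
noncomputable def stdCdf (t : ℝ) : ℝ := (gaussianReal 0 1).real (Iic t)

lemma stdCdf_nonneg (t : ℝ) : 0 ≤ stdCdf t := measureReal_nonneg

lemma stdCdf_le_one (t : ℝ) : stdCdf t ≤ 1 := measureReal_le_one

lemma monotone_stdCdf : Monotone stdCdf := fun _ _ h =>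
  measureReal_mono (Iic_subset_Iic.2 h)

lemma abs_stdCdf_sub_le_one (a b : ℝ) : |stdCdf a - stdCdf b| ≤ 1 := by
  rw [abs_le]
  constructor <;> linarith [stdCdf_nonneg a, stdCdf_nonneg b, stdCdf_le_one a, stdCdf_le_one b]

lemma gaussianPDFReal_le_exp (x : ℝ) : gaussianPDFReal 0 1 x ≤ Real.exp (-(x ^ 2 / 2)) := by
  have h1 : (√(2 * Real.pi * ((1 : NNReal) : ℝ)))⁻¹ ≤ 1 := by
    apply inv_le_one_of_one_le₀
    rw [Real.one_le_sqrt, NNReal.coe_one]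
    linarith [Real.pi_gt_three]
  have h2 : gaussianPDFReal 0 1 x
      = (√(2 * Real.pi * ((1 : NNReal) : ℝ)))⁻¹ * Real.exp (-(x ^ 2 / 2)) := by
    rw [gaussianPDFReal_def]; simp [neg_div]
  rw [h2]
  exact mul_le_of_le_one_left (Real.exp_pos _).le h1

lemma gaussianPDFReal_le_one (x : ℝ) : gaussianPDFReal 0 1 x ≤ 1 :=
  (gaussianPDFReal_le_exp x).trans (Real.exp_le_one_iff.2 (by nlinarith [sq_nonneg x]))

lemma abs_mul_gaussianPDFReal_le_one (x : ℝ) : |x| * gaussianPDFReal 0 1 x ≤ 1 := by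
  have h1 := gaussianPDFReal_le_exp x
  have h2 : |x| ≤ Real.exp (x ^ 2 / 2) := by
    have := Real.add_one_le_exp (x ^ 2 / 2)
    nlinarith [sq_nonneg (|x| - 1), sq_abs x]
  calc |x| * gaussianPDFReal 0 1 x ≤ Real.exp (x ^ 2 / 2) * Real.exp (-(x ^ 2 / 2)) := by
        gcongr; exact gaussianPDFReal_nonneg _ _ _
    _ = 1 := by rw [← Real.exp_add]; simp

lemma stdCdf_sub_le {a b B : ℝ} (hab : a ≤ b)
    (hB : ∀ x, a < x → x ≤ b → gaussianPDFReal 0 1 x ≤ B) :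
    |stdCdf b - stdCdf a| ≤ B * (b - a) := by
  have h1 : stdCdf b - stdCdf a = (gaussianReal 0 1).real (Ioc a b) := by
    have hd : Iic b \ Iic a = Ioc a b := by
      ext x; simp [and_comm]
    rw [← hd, measureReal_sdiff (Iic_subset_Iic.2 hab) measurableSet_Iic]
    rfl
  have h2 : (gaussianReal 0 1).real (Ioc a b) = ∫ x in Ioc a b, gaussianPDFReal 0 1 x := by
    rw [measureReal_def, gaussianReal_apply_eq_integral _ one_ne_zero, ENNReal.toReal_ofReal]
    exact integral_nonneg fun x => gaussianPDFReal_nonneg _ _ _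
  rw [h1, h2, ← Real.norm_eq_abs]
  refine (norm_setIntegral_le_of_norm_le_const (C := B) (by simp) fun x hx => ?_).trans ?_
  · rw [Real.norm_of_nonneg (gaussianPDFReal_nonneg _ _ _)]
    exact hB x hx.1 hx.2
  · simp [hab]

lemma abs_stdCdf_sub_le (a b : ℝ) : |stdCdf a - stdCdf b| ≤ |a - b| := by
  rcases le_total a b with h | h
  · rw [abs_sub_comm, abs_sub_comm a b, abs_of_nonneg (sub_nonneg.2 h)]
    simpa using stdCdf_sub_le h fun x _ _ => gaussianPDFReal_le_one x
  · rw [abs_of_nonneg (sub_nonneg.2 h)]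
    simpa using stdCdf_sub_le h fun x _ _ => gaussianPDFReal_le_one x

lemma abs_stdCdf_mul_sub_le {c : ℝ} (hc : 1 ≤ c) (t : ℝ) :
    |stdCdf (c * t) - stdCdf t| ≤ c - 1 := by
  have key : ∀ s x : ℝ, 0 < s → s ≤ |x| → gaussianPDFReal 0 1 x ≤ 1 / s := by
    intro s x hs hx
    rw [le_div_iff₀ hs, mul_comm]
    exact (mul_le_mul_of_nonneg_right hx (gaussianPDFReal_nonneg _ _ _)).trans
      (abs_mul_gaussianPDFReal_le_one x)
  rcases lt_trichotomy t 0 with h | h | h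
  · have hle : c * t ≤ t := by nlinarith
    rw [abs_sub_comm]
    refine (stdCdf_sub_le (B := 1 / -t) hle fun x _ h2 => key _ _ (by linarith) ?_).trans
      (le_of_eq ?_)
    · rw [abs_of_neg (by linarith)]; linarith
    · field_simp [h.ne]; ring
  · subst h; simp [hc]
  · have hle : t ≤ c * t := by nlinarith
    refine (stdCdf_sub_le (B := 1 / t) hle fun x h1 _ => key _ _ h ?_).trans (le_of_eq ?_)
    · rw [abs_of_pos (by linarith)]; exact h1.le
    · field_simp

lemma gaussianReal_real_Iic {c : ℝ} (hc : 0 < c) (t : ℝ) :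
    (gaussianReal 0 (c ^ 2).toNNReal).real (Iic t) = stdCdf (t / c) := by
  have h : gaussianReal 0 (c ^ 2).toNNReal = (gaussianReal 0 1).map (c * ·) := by
    rw [gaussianReal_map_const_mul]
    congr 1
    · simp
    · ext; simp [sq_nonneg]
  rw [h, map_measureReal_apply (by fun_prop) measurableSet_Iic, stdCdf]
  congr 1
  ext x
  simp [le_div_iff₀ hc, mul_comm]

lemma abs_stdCdf_shrink_sub_le {η : ℝ} (h0 : 0 ≤ η) (h1 : η ≤ 1 / 2) (t a : ℝ) :
    |stdCdf ((t - a) / √(1 - η)) - stdCdf t| ≤ 2 * |a| + 2 * η := by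
  have hs : 1 - η ≤ √(1 - η) := by
    rw [Real.le_sqrt' (by linarith)]; nlinarith
  have hs1 : √(1 - η) ≤ 1 := Real.sqrt_le_one.2 (by linarith)
  have hs0 : 0 < √(1 - η) := by linarith
  set c := 1 / √(1 - η) with hc
  have hc1 : 1 ≤ c := by rw [hc, le_div_iff₀ hs0]; linarith
  have hc2 : c ≤ 1 + 2 * η := by
    rw [hc, div_le_iff₀ hs0]; nlinarith
  have e : (t - a) / √(1 - η) = c * (t - a) := by rw [hc]; ring
  have h3 := abs_stdCdf_mul_sub_le hc1 t
  have h4 := abs_stdCdf_sub_le (c * (t - a)) (c * t)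
  have h5 : |c * (t - a) - c * t| = c * |a| := by
    rw [show c * (t - a) - c * t = -(c * a) by ring, abs_neg, abs_mul, abs_of_nonneg (by linarith)]
  have h6 := abs_sub_le (stdCdf (c * (t - a))) (stdCdf (c * t)) (stdCdf t)
  rw [e]
  nlinarith [abs_nonneg a]

end StandardNormal

section GaussianSplitting

open scoped RealInnerProductSpace in
lemma abs_norm_sq_sum_smul_sub_le {ι E : Type*} [Fintype ι] [DecidableEq ι]
    [NormedAddCommGroup E] [InnerProductSpace ℝ E] {y : ι → E} {M : ℝ}
    (hM : ∀ i j, |⟪y i, y j⟫ - (if i = j then 1 else 0)| ≤ M) (t : ι → ℝ) :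
    |‖∑ i, t i • y i‖ ^ 2 - ∑ i, t i ^ 2| ≤ Fintype.card ι * M * ∑ i, t i ^ 2 := by
  by_cases hne : Nonempty ι
  swap
  · rw [not_nonempty_iff] at hne; simp
  have hM0 : 0 ≤ M := (abs_nonneg _).trans (hM hne.some hne.some)
  have h1 : ‖∑ i, t i • y i‖ ^ 2 - ∑ i, t i ^ 2
      = ∑ i, ∑ j, t i * t j * (⟪y i, y j⟫ - (if i = j then 1 else 0)) := by
    rw [← real_inner_self_eq_norm_sq, sum_inner]
    simp_rw [inner_sum, real_inner_smul_left, real_inner_smul_right, mul_sub,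
      Finset.sum_sub_distrib]
    congr 1
    · exact Finset.sum_congr rfl fun i _ => Finset.sum_congr rfl fun j _ => by ring
    · simp [sq]
  rw [h1]
  calc |∑ i, ∑ j, t i * t j * (⟪y i, y j⟫ - (if i = j then 1 else 0))|
      ≤ ∑ i, ∑ j, |t i| * |t j| * M := by
        refine (Finset.abs_sum_le_sum_abs _ _).trans (Finset.sum_le_sum fun i _ => ?_)
        refine (Finset.abs_sum_le_sum_abs _ _).trans (Finset.sum_le_sum fun j _ => ?_)
        rw [abs_mul, abs_mul]
        exact mul_le_mul_of_nonneg_left (hM i j) (by positivity)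
    _ = M * (∑ i, |t i|) ^ 2 := by
        rw [sq, Finset.sum_mul_sum, Finset.mul_sum]
        refine Finset.sum_congr rfl fun i _ => ?_
        rw [Finset.mul_sum]
        exact Finset.sum_congr rfl fun j _ => by ring
    _ ≤ M * (Fintype.card ι * ∑ i, |t i| ^ 2) := by
        gcongr
        simpa using sq_sum_le_card_mul_sum_sq (s := Finset.univ) (f := fun i => |t i|)
    _ = Fintype.card ι * M * ∑ i, t i ^ 2 := by simp_rw [sq_abs]; ring

open scoped RealInnerProductSpace

variable {ι : Type*} [Fintype ι] [DecidableEq ι] {d : ℕ}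

/-- The covariance `Gram(y) - (1 - η) I`, which remains after splitting off independent noise of
variance `1 - η` from each coordinate. -/
noncomputable def residualCov (y : ι → Vec d) (η : ℝ) : Matrix ι ι ℝ :=
  Matrix.of fun i j => ⟪y i, y j⟫ - (if i = j then 1 - η else 0)

lemma dotProduct_residualCov (y : ι → Vec d) (η : ℝ) (t : ι → ℝ) :
    t ⬝ᵥ (residualCov y η).mulVec t = ‖∑ i, t i • y i‖ ^ 2 - (1 - η) * ∑ i, t i ^ 2 := by
  rw [← real_inner_self_eq_norm_sq, sum_inner]
  simp_rw [inner_sum, real_inner_smul_left, real_inner_smul_right, dotProduct, Matrix.mulVec,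
    dotProduct, residualCov, Matrix.of_apply, sub_mul, Finset.sum_sub_distrib, mul_sub,
    Finset.sum_sub_distrib, Finset.mul_sum]
  congr 1
  · exact Finset.sum_congr rfl fun i _ => Finset.sum_congr rfl fun j _ => by ring
  · simp only [mul_ite, ite_mul, mul_zero, zero_mul, Finset.sum_ite_eq, Finset.mem_univ, if_true,
      ← Finset.sum_sub_distrib]
    exact Finset.sum_congr rfl fun i _ => by ring

variable {y : ι → Vec d} {M η : ℝ}

lemma posSemidef_residualCov (hM : ∀ i j, |⟪y i, y j⟫ - (if i = j then 1 else 0)| ≤ M)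
    (hη : Fintype.card ι * M ≤ η) : (residualCov y η).PosSemidef := by
  refine Matrix.PosSemidef.of_dotProduct_mulVec_nonneg ?_ fun t => ?_
  · ext i j
    simp [residualCov, real_inner_comm, eq_comm]
  · rw [star_trivial, dotProduct_residualCov]
    have h := (abs_le.1 (abs_norm_sq_sum_smul_sub_le hM t)).1
    have h2 : 0 ≤ ∑ i, t i ^ 2 := Finset.sum_nonneg fun i _ => sq_nonneg _
    nlinarith

lemma dotProduct_residualCov_le (hM : ∀ i j, |⟪y i, y j⟫ - (if i = j then 1 else 0)| ≤ M)
    (hη : Fintype.card ι * M ≤ η) (t : ι → ℝ) :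
    t ⬝ᵥ (residualCov y η).mulVec t ≤ 2 * η * ∑ i, t i ^ 2 := by
  rw [dotProduct_residualCov]
  have h := (abs_le.1 (abs_norm_sq_sum_smul_sub_le hM t)).2
  have h2 : 0 ≤ ∑ i, t i ^ 2 := Finset.sum_nonneg fun i _ => sq_nonneg _
  nlinarith

/-- The law of the Gaussian vector `(⟨y i, x⟩)_i` splits into independent noise and a Gaussian
vector of covariance `residualCov y η`. -/
lemma map_inner_stdGaussian_eq_conv (hη1 : η ≤ 1) (hS : (residualCov y η).PosSemidef) :
    (stdGaussian (Vec d)).map (fun x => WithLp.toLp 2 (fun i => ⟪y i, x⟫)) =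
      (multivariateGaussian 0 (residualCov y η)) ∗
        ((Measure.pi fun _ : ι => gaussianReal 0 (1 - η).toNNReal).map (WithLp.toLp 2)) := by
  have : IsProbabilityMeasure
      ((stdGaussian (Vec d)).map (fun x => WithLp.toLp 2 (fun i => ⟪y i, x⟫))) :=
    Measure.isProbabilityMeasure_map (by fun_prop)
  have : IsProbabilityMeasure
      ((Measure.pi fun _ : ι => gaussianReal 0 (1 - η).toNNReal).map (WithLp.toLp 2)) :=
    Measure.isProbabilityMeasure_map (by fun_prop)
  refine Measure.ext_of_charFun (E := EuclideanSpace ℝ ι) (funext fun t => ?_)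
  rw [charFun_conv, charFun_multivariateGaussian hS, charFun_pi, charFun_apply,
    integral_map (by fun_prop) (by fun_prop)]
  have h1 : ∀ x : Vec d, ⟪(WithLp.toLp 2 (fun i => ⟪y i, x⟫) : EuclideanSpace ℝ ι), t⟫
      = ⟪x, ∑ i, t i • y i⟫ := by
    intro x
    rw [PiLp.inner_apply, inner_sum]
    refine Finset.sum_congr rfl fun i _ => ?_
    rw [real_inner_smul_right, ← real_inner_comm x (y i)]
    simp
  simp_rw [h1, ← charFun_apply (μ := stdGaussian (Vec d)), charFun_stdGaussian,
    charFun_gaussianReal, dotProduct_residualCov, ← Complex.exp_sum, ← Complex.exp_add]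
  congr 1
  have h2 : (((1 - η).toNNReal : ℝ) : ℂ) = ((1 - η : ℝ) : ℂ) := by
    rw [Real.coe_toNNReal _ (by linarith)]
  simp only [inner_zero_right, Complex.ofReal_zero, zero_mul, mul_zero, zero_sub, h2,
    Finset.sum_neg_distrib]
  push_cast
  rw [← Finset.sum_div, ← Finset.mul_sum]
  ring

lemma integral_exp_inner_multivariateGaussian {S : Matrix ι ι ℝ} (hS : S.PosSemidef)
    (t : EuclideanSpace ℝ ι) :
    Integrable (fun a => Real.exp ⟪t, a⟫) (multivariateGaussian 0 S) ∧
      ∫ a, Real.exp ⟪t, a⟫ ∂(multivariateGaussian 0 S)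
        = Real.exp ((t : ι → ℝ) ⬝ᵥ S.mulVec t / 2) := by
  have h := IsGaussian.map_eq_gaussianReal (μ := multivariateGaussian 0 S) (innerSL ℝ t)
  have h0 : (multivariateGaussian 0 S)[innerSL ℝ t] = 0 := by
    rw [(innerSL ℝ t).integral_comp_id_comm IsGaussian.integrable_id,
      integral_id_multivariateGaussian, map_zero]
  have hv : Var[innerSL ℝ t; multivariateGaussian 0 S] = (t : ι → ℝ) ⬝ᵥ S.mulVec t := by
    rw [← covarianceBilin_multivariateGaussian (μ := 0) hS, covarianceBilin_self]
    · rfl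
    · exact IsGaussian.memLp_two_id
  rw [h0, hv] at h
  have hq : 0 ≤ (t : ι → ℝ) ⬝ᵥ S.mulVec t := by
    simpa using hS.dotProduct_mulVec_nonneg (t : ι → ℝ)
  have h3 := mgf_gaussianReal h 1
  simp only [mgf, one_mul, zero_add, innerSL_apply_apply, one_pow, mul_one,
    Real.coe_toNNReal _ hq] at h3
  refine ⟨?_, h3⟩
  by_contra hn
  rw [integral_undef hn] at h3
  exact absurd h3 (Real.exp_pos _).ne

end GaussianSplitting

section ProductsOfSteps

open scoped RealInnerProductSpace

/-- The centred step function `u ↦ 1[u ≤ t] - p`. -/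
noncomputable def centredStep (p t u : ℝ) : ℝ := (Iic t).indicator 1 u - p

@[fun_prop]
lemma measurable_centredStep (p t : ℝ) : Measurable (centredStep p t) :=
  (measurable_one.indicator measurableSet_Iic).sub_const p

lemma abs_centredStep_le_one {p : ℝ} (hp0 : 0 ≤ p) (hp1 : p ≤ 1) (t u : ℝ) :
    |centredStep p t u| ≤ 1 := by
  rw [centredStep, indicator_apply, abs_le]
  split_ifs <;> simp <;> constructor <;> linarith

lemma integral_centredStep {Ω : Type*} {mΩ : MeasurableSpace Ω} {μ : Measure Ω}
    [IsProbabilityMeasure μ] {f : Ω → ℝ} (hf : Measurable f) (p t : ℝ) :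
    ∫ x, centredStep p t (f x) ∂μ = μ.real (f ⁻¹' Iic t) - p := by
  have h : (fun x => (Iic t).indicator (1 : ℝ → ℝ) (f x)) = (f ⁻¹' Iic t).indicator 1 := by
    ext x; by_cases hx : f x ≤ t <;> simp [hx]
  simp only [centredStep]
  rw [integral_sub _ (integrable_const _), h, integral_indicator_one (hf measurableSet_Iic)]
  · simp
  · rw [h]
    exact (integrable_const (1 : ℝ)).indicator (hf measurableSet_Iic)

lemma integral_centredStep_add_gaussianReal {c : ℝ} (hc : 0 < c) (p t a : ℝ) :
    ∫ z, centredStep p t (a + z) ∂(gaussianReal 0 (c ^ 2).toNNReal)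
      = stdCdf ((t - a) / c) - p := by
  rw [integral_centredStep (by fun_prop), ← gaussianReal_real_Iic hc]
  congr 2
  ext z
  simp [le_sub_iff_add_le']

lemma abs_prod_centredStep_le_one {ι : Type*} {p : ℝ} (hp0 : 0 ≤ p) (hp1 : p ≤ 1) (t : ℝ)
    (s : Finset ι) (u : ι → ℝ) : |∏ i ∈ s, centredStep p t (u i)| ≤ 1 := by
  rw [Finset.abs_prod]
  exact Finset.prod_le_one (fun _ _ => abs_nonneg _) fun _ _ => abs_centredStep_le_one hp0 hp1 _ _

variable {ι : Type*} [Fintype ι] [DecidableEq ι] {d : ℕ}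

lemma exp_abs_le_add (x : ℝ) : Real.exp |x| ≤ Real.exp x + Real.exp (-x) := by
  rcases abs_choice x with h | h <;> rw [h] <;> linarith [Real.exp_pos x, Real.exp_pos (-x)]

/-- Exponential moments of the `ℓ¹` norm of a Gaussian vector, from those of its signed sums. -/
lemma integral_exp_sum_abs_le {S : Matrix ι ι ℝ} (hS : S.PosSemidef) {v : ℝ}
    (hv : ∀ t : ι → ℝ, t ⬝ᵥ S.mulVec t ≤ v * ∑ i, t i ^ 2) (c : ℝ) :
    Integrable (fun a : EuclideanSpace ℝ ι => ∏ i, Real.exp |c * a i|) (multivariateGaussian 0 S) ∧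
      ∫ a, ∏ i, Real.exp |c * a i| ∂(multivariateGaussian 0 S)
        ≤ (2 * Real.exp (v * c ^ 2 / 2)) ^ Fintype.card ι := by
  let sg : (ι → Bool) → EuclideanSpace ℝ ι := fun b => WithLp.toLp 2 fun i => if b i then c else -c
  have hle : ∀ a : EuclideanSpace ℝ ι,
      ∏ i, Real.exp |c * a i| ≤ ∑ b : ι → Bool, Real.exp ⟪sg b, a⟫ := by
    intro a
    have h1 : ∏ i, (∑ b : Bool, Real.exp ((if b then c else -c) * a i))
        = ∑ b : ι → Bool, Real.exp ⟪sg b, a⟫ := by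
      rw [Finset.prod_univ_sum, Fintype.piFinset_univ]
      refine Finset.sum_congr rfl fun b _ => ?_
      rw [← Real.exp_sum, PiLp.inner_apply]
      simp [sg, mul_comm]
    rw [← h1]
    refine Finset.prod_le_prod (fun _ _ => (Real.exp_pos _).le) fun i _ => ?_
    simpa using exp_abs_le_add (c * a i)
  have hint : Integrable (fun a => ∑ b : ι → Bool, Real.exp ⟪sg b, a⟫)
      (multivariateGaussian 0 S) :=
    integrable_finsetSum _ fun b _ => (integral_exp_inner_multivariateGaussian hS _).1
  have hI : Integrable (fun a : EuclideanSpace ℝ ι => ∏ i, Real.exp |c * a i|)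
      (multivariateGaussian 0 S) := by
    refine hint.mono' (by fun_prop) (ae_of_all _ fun a => ?_)
    rw [Real.norm_of_nonneg (Finset.prod_nonneg fun _ _ => (Real.exp_pos _).le)]
    exact hle a
  refine ⟨hI, (integral_mono hI hint hle).trans ?_⟩
  rw [integral_finsetSum _ fun b _ => (integral_exp_inner_multivariateGaussian hS _).1]
  have hb : ∀ b : ι → Bool, ∫ a, Real.exp ⟪sg b, a⟫ ∂(multivariateGaussian 0 S)
      ≤ Real.exp (v * c ^ 2 / 2) ^ Fintype.card ι := by
    intro b
    rw [(integral_exp_inner_multivariateGaussian hS _).2, ← Real.exp_nat_mul, Real.exp_le_exp]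
    have := hv (sg b)
    have h2 : ∑ i, (sg b) i ^ 2 = Fintype.card ι * c ^ 2 := by
      have : ∀ i, (sg b) i ^ 2 = c ^ 2 := fun i => by
        simp only [sg]; split_ifs <;> ring
      simp [this]
    rw [h2] at this
    linarith
  refine (Finset.sum_le_sum fun b _ => hb b).trans (le_of_eq ?_)
  simp [mul_pow]

variable {y : ι → Vec d} {M η : ℝ}

/-- A product of centred indicators of nearly uncorrelated Gaussian variables has small mean. -/
theorem abs_integral_prod_centredStep_le {p t K : ℝ} (hp0 : 0 ≤ p) (hp1 : p ≤ 1) (hK : 0 ≤ K)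
    (hη0 : 0 < η) (hη1 : η ≤ 1 / 2)
    (hM : ∀ i j, |⟪y i, y j⟫ - (if i = j then 1 else 0)| ≤ M)
    (hη : Fintype.card ι * M ≤ η) (ht : |stdCdf t - p| ≤ K * √η) :
    |∫ x, ∏ i, centredStep p t ⟪y i, x⟫ ∂(stdGaussian (Vec d))|
      ≤ (2 * Real.exp 4 * (K + 2) * √η) ^ Fintype.card ι := by
  have hS := posSemidef_residualCov hM hη
  have hc : 0 < √(1 - η) := Real.sqrt_pos.2 (by linarith)
  have hc2 : √(1 - η) ^ 2 = 1 - η := Real.sq_sqrt (by linarith)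
  set ν : Measure (EuclideanSpace ℝ ι) :=
    (Measure.pi fun _ : ι => gaussianReal 0 (1 - η).toNNReal).map (WithLp.toLp 2) with hν
  have : IsProbabilityMeasure ν := Measure.isProbabilityMeasure_map (by fun_prop)
  have h1 : ∫ x, ∏ i, centredStep p t ⟪y i, x⟫ ∂(stdGaussian (Vec d))
      = ∫ a, ∏ i, (stdCdf ((t - a i) / √(1 - η)) - p)
          ∂(multivariateGaussian 0 (residualCov y η)) := by
    have hmeas : Measurable fun w : EuclideanSpace ℝ ι => ∏ i, centredStep p t (w i) := by
      fun_prop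
    have e1 : ∫ x, ∏ i, centredStep p t ⟪y i, x⟫ ∂(stdGaussian (Vec d))
        = ∫ w : EuclideanSpace ℝ ι, ∏ i, centredStep p t (w i)
          ∂((stdGaussian (Vec d)).map (fun x => WithLp.toLp 2 (fun i => ⟪y i, x⟫))) := by
      rw [integral_map (by fun_prop) hmeas.aestronglyMeasurable]
    rw [e1, map_inner_stdGaussian_eq_conv (by linarith) hS, ← hν, integral_conv]
    · refine integral_congr_ae (ae_of_all _ fun a => ?_)
      have hm2 : Measurable fun w : EuclideanSpace ℝ ι => ∏ i, centredStep p t ((a + w) i) := by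
        fun_prop
      simp only
      rw [hν, integral_map (by fun_prop) hm2.aestronglyMeasurable]
      simp only [PiLp.add_apply]
      rw [integral_fintype_prod_eq_prod (fun i z => centredStep p t (a i + z))]
      refine Finset.prod_congr rfl fun i _ => ?_
      rw [← integral_centredStep_add_gaussianReal hc, hc2]
    · refine Integrable.of_bound hmeas.aestronglyMeasurable 1 (ae_of_all _ fun w => ?_)
      exact abs_prod_centredStep_le_one hp0 hp1 t _ _
  set β := (K + 2) * √η with hβ
  have hsη : η ≤ √η := Real.le_sqrt_of_sq_le (by nlinarith)
  have hβ2 : 2 * √η ≤ β := by rw [hβ]; nlinarith [Real.sqrt_nonneg η]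
  have hβ0 : 0 < β := lt_of_lt_of_le (by positivity) hβ2
  have hβη : 4 * η ≤ β ^ 2 := by nlinarith [Real.sq_sqrt hη0.le, Real.sqrt_nonneg η]
  have hpt : ∀ u : ℝ, |stdCdf ((t - u) / √(1 - η)) - p| ≤ β * Real.exp |2 / β * u| := by
    intro u
    have h2 := abs_stdCdf_shrink_sub_le hη0.le hη1 t u
    have h3 := abs_sub_le (stdCdf ((t - u) / √(1 - η))) (stdCdf t) p
    have h4 : |2 / β * u| = 2 * |u| / β := by
      rw [abs_mul, abs_of_pos (by positivity : 0 < 2 / β)]; ring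
    have h5 := Real.add_one_le_exp |2 / β * u|
    have h6 : β * |2 / β * u| = 2 * |u| := by rw [h4]; field_simp
    nlinarith [mul_le_mul_of_nonneg_left h5 hβ0.le]
  obtain ⟨hI, hle⟩ := integral_exp_sum_abs_le hS (v := 2 * η)
    (fun t => dotProduct_residualCov_le hM hη t) (2 / β)
  rw [h1, ← Real.norm_eq_abs]
  refine (norm_integral_le_of_norm_le (hI.const_mul (β ^ Fintype.card ι))
    (ae_of_all _ fun a => ?_)).trans ?_
  · rw [Real.norm_eq_abs, Finset.abs_prod]
    refine (Finset.prod_le_prod (fun _ _ => abs_nonneg _) fun i _ => hpt (a i)).trans (le_of_eq ?_)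
    rw [Finset.prod_mul_distrib]
    simp
  · rw [integral_const_mul]
    refine (mul_le_mul_of_nonneg_left hle (by positivity)).trans ?_
    rw [← mul_pow]
    refine pow_le_pow_left₀ (by positivity) ?_ _
    have h7 : Real.exp (2 * η * (2 / β) ^ 2 / 2) ≤ Real.exp 4 := by
      rw [Real.exp_le_exp, div_pow]
      have : η / β ^ 2 ≤ 1 / 4 := by rw [div_le_iff₀ (by positivity)]; linarith
      calc 2 * η * (2 ^ 2 / β ^ 2) / 2 = 4 * (η / β ^ 2) := by ring
        _ ≤ 4 := by linarith
    calc β * (2 * Real.exp (2 * η * (2 / β) ^ 2 / 2)) ≤ β * (2 * Real.exp 4) := by gcongr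
      _ = 2 * Real.exp 4 * (K + 2) * √η := by rw [hβ]; ring

end ProductsOfSteps

section Moments

open scoped RealInnerProductSpace

lemma integral_exp_mul_sq_gaussianReal {μ : ℝ} (hμ : μ < 1 / 2) :
    ∫ x, Real.exp (μ * x ^ 2) ∂(gaussianReal 0 1) = √(1 / (1 - 2 * μ)) := by
  rw [integral_gaussianReal_eq_integral_smul one_ne_zero]
  have h : ∀ x : ℝ, gaussianPDFReal 0 1 x • Real.exp (μ * x ^ 2)
      = (√(2 * Real.pi))⁻¹ * Real.exp (-(1 / 2 - μ) * x ^ 2) := by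
    intro x
    rw [gaussianPDFReal_def]
    simp only [NNReal.coe_one, mul_one, sub_zero, smul_eq_mul]
    rw [mul_assoc, ← Real.exp_add]
    congr 2
    ring
  simp_rw [h]
  rw [integral_const_mul, integral_gaussian, ← Real.sqrt_inv, ← Real.sqrt_mul (by positivity)]
  congr 1
  have : 1 - 2 * μ ≠ 0 := by linarith
  have : 1 / 2 - μ ≠ 0 := by linarith
  have := Real.pi_pos.ne'
  field_simp

lemma integral_exp_mul_norm_sq_stdGaussian {d : ℕ} {μ : ℝ} (hμ : μ < 1 / 2) :
    Integrable (fun x : Vec d => Real.exp (μ * ‖x‖ ^ 2)) (stdGaussian (Vec d)) ∧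
      ∫ x : Vec d, Real.exp (μ * ‖x‖ ^ 2) ∂(stdGaussian (Vec d)) = √(1 / (1 - 2 * μ)) ^ d := by
  have h : ∫ x : Vec d, Real.exp (μ * ‖x‖ ^ 2) ∂(stdGaussian (Vec d))
      = √(1 / (1 - 2 * μ)) ^ d := by
    rw [← map_pi_eq_stdGaussian, integral_map (by fun_prop) (by fun_prop)]
    simp_rw [EuclideanSpace.norm_sq_eq, Finset.mul_sum, Real.exp_sum, Real.norm_eq_abs, sq_abs]
    rw [integral_fintype_prod_eq_pow (fun x => Real.exp (μ * x ^ 2)),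
      integral_exp_mul_sq_gaussianReal hμ, Fintype.card_fin]
  refine ⟨?_, h⟩
  by_contra hn
  rw [integral_undef hn] at h
  have : 0 < 1 - 2 * μ := by linarith
  have : 0 < √(1 / (1 - 2 * μ)) ^ d := by positivity
  linarith

lemma lintegral_exp_mul_norm_sq_le {d : ℕ} {μ : ℝ} (hμ : |μ| ≤ 1 / 4) :
    ∫⁻ x : Vec d, ENNReal.ofReal (Real.exp (μ * ‖x‖ ^ 2)) ∂(stdGaussian (Vec d))
      ≤ ENNReal.ofReal (Real.exp (μ * d + 4 * μ ^ 2 * d)) := by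
  obtain ⟨hl, hr⟩ := abs_le.1 hμ
  obtain ⟨hi, he⟩ := integral_exp_mul_norm_sq_stdGaussian (d := d) (μ := μ) (by linarith)
  rw [← ofReal_integral_eq_lintegral_ofReal hi (ae_of_all _ fun x => (Real.exp_pos _).le), he]
  refine ENNReal.ofReal_le_ofReal ?_
  have h1 : 0 < 1 - 2 * μ := by linarith
  have h2 : -Real.log (1 - 2 * μ) ≤ 2 * μ + 8 * μ ^ 2 := by
    have habs : |2 * μ| ≤ 1 / 2 := by rw [abs_mul, abs_two]; linarith
    have h3 := Real.abs_log_sub_add_sum_range_le (x := 2 * μ) (by linarith) 1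
    have h4 : |2 * μ| ^ (1 + 1) / (1 - |2 * μ|) ≤ 8 * μ ^ 2 := by
      rw [div_le_iff₀ (by linarith), show (1 + 1 : ℕ) = 2 from rfl, sq_abs]
      nlinarith [sq_nonneg μ]
    have h5 := (abs_le.1 (h3.trans h4)).1
    simp at h5
    linarith
  have h6 : √(1 / (1 - 2 * μ)) ≤ Real.exp (μ + 4 * μ ^ 2) := by
    rw [Real.sqrt_le_left (Real.exp_pos _).le, ← Real.exp_nat_mul, ← Real.exp_log h1, one_div,
      ← Real.exp_neg, Real.exp_le_exp]
    push_cast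
    linarith
  calc √(1 / (1 - 2 * μ)) ^ d ≤ Real.exp (μ + 4 * μ ^ 2) ^ d := by gcongr
    _ = Real.exp (μ * d + 4 * μ ^ 2 * d) := by rw [← Real.exp_nat_mul]; congr 1; ring

lemma lintegral_exp_mul_inner {d : ℕ} (μ : ℝ) (y : Vec d) :
    ∫⁻ x : Vec d, ENNReal.ofReal (Real.exp (μ * ⟪y, x⟫)) ∂(stdGaussian (Vec d))
      = ENNReal.ofReal (Real.exp (μ ^ 2 / 2 * ‖y‖ ^ 2)) := by
  have h := IsGaussian.map_eq_gaussianReal (μ := stdGaussian (Vec d)) (innerSL ℝ y)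
  rw [integral_strongDual_stdGaussian, variance_dual_stdGaussian, innerSL_apply_norm] at h
  have h3 := mgf_gaussianReal h μ
  simp only [mgf, zero_mul, zero_add, innerSL_apply_apply,
    Real.coe_toNNReal _ (sq_nonneg ‖y‖)] at h3
  rw [← ofReal_integral_eq_lintegral_ofReal _ (ae_of_all _ fun x => (Real.exp_pos _).le), h3]
  · congr 2; ring
  · by_contra hn
    rw [integral_undef hn] at h3
    exact absurd h3 (Real.exp_pos _).ne

/-- Moments from two-sided exponential moments. -/
lemma lintegral_abs_div_rpow_le {Ω : Type*} {mΩ : MeasurableSpace Ω} {P : Measure Ω} {u : Ω → ℝ}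
    (hu : Measurable u) {D q : ℝ} (hD : 0 < D) (hq : 0 < q)
    (h : ∀ μ : ℝ, |μ| = √(q / D) →
      ∫⁻ x, ENNReal.ofReal (Real.exp (μ * u x)) ∂P ≤ ENNReal.ofReal (Real.exp (4 * μ ^ 2 * D))) :
    ∫⁻ x, ENNReal.ofReal (|u x / D| ^ q) ∂P
      ≤ ENNReal.ofReal (2 * (Real.exp 4 * √(q / D)) ^ q) := by
  set l := √(q / D) with hl
  have hl0 : 0 < l := by positivity
  have hl2 : l ^ 2 * D = q := by rw [hl, Real.sq_sqrt (by positivity)]; field_simp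
  have hpt : ∀ v : ℝ, |v / D| ^ q ≤ l ^ q * (Real.exp (l * v) + Real.exp (-l * v)) := by
    intro v
    have h1 : |v / D| ≤ l * Real.exp (|l * v| / q) := by
      have h2 := Real.add_one_le_exp (|l * v| / q)
      have h3 : |v / D| = l * (|l * v| / q) := by
        rw [abs_div, abs_of_pos hD, abs_mul, abs_of_pos hl0, ← hl2]; field_simp
      rw [h3]
      exact mul_le_mul_of_nonneg_left (by linarith) hl0.le
    calc |v / D| ^ q ≤ (l * Real.exp (|l * v| / q)) ^ q :=
          Real.rpow_le_rpow (abs_nonneg _) h1 hq.le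
      _ = l ^ q * Real.exp |l * v| := by
          rw [Real.mul_rpow hl0.le (Real.exp_pos _).le, ← Real.exp_mul]
          congr 2; field_simp
      _ ≤ _ := by
          rw [neg_mul]
          exact mul_le_mul_of_nonneg_left (exp_abs_le_add _) (by positivity)
  calc ∫⁻ x, ENNReal.ofReal (|u x / D| ^ q) ∂P
      ≤ ∫⁻ x, ENNReal.ofReal (l ^ q) * (ENNReal.ofReal (Real.exp (l * u x))
          + ENNReal.ofReal (Real.exp (-l * u x))) ∂P := by
        refine lintegral_mono fun x => ?_
        rw [← ENNReal.ofReal_add (Real.exp_pos _).le (Real.exp_pos _).le,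
          ← ENNReal.ofReal_mul (by positivity)]
        exact ENNReal.ofReal_le_ofReal (hpt _)
    _ = ENNReal.ofReal (l ^ q) * (∫⁻ x, ENNReal.ofReal (Real.exp (l * u x)) ∂P
          + ∫⁻ x, ENNReal.ofReal (Real.exp (-l * u x)) ∂P) := by
        rw [lintegral_const_mul _ (by fun_prop), lintegral_add_left (by fun_prop)]
    _ ≤ ENNReal.ofReal (l ^ q) * (ENNReal.ofReal (Real.exp (4 * q))
          + ENNReal.ofReal (Real.exp (4 * q))) := by
        have e1 := h l (abs_of_pos hl0)
        have e2 := h (-l) (by rw [abs_neg, abs_of_pos hl0])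
        rw [neg_sq] at e2
        rw [mul_assoc, hl2] at e1 e2
        gcongr
    _ = _ := by
        rw [← ENNReal.ofReal_add (Real.exp_pos _).le (Real.exp_pos _).le,
          ← ENNReal.ofReal_mul (by positivity), Real.mul_rpow (Real.exp_pos _).le hl0.le,
          ← Real.exp_mul]
        congr 1; ring

lemma sqrt_div_le_quarter {D q : ℝ} (hD : 0 < D) (hqD : 16 * q ≤ D) : √(q / D) ≤ 1 / 4 := by
  rw [Real.sqrt_le_left (by norm_num), div_le_iff₀ hD]
  linarith

lemma lintegral_abs_norm_sq_div_sub_one_rpow_le {d : ℕ} (hd : 0 < d) {q : ℝ} (hq : 0 < q)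
    (hqd : 16 * q ≤ d) :
    ∫⁻ x : Vec d, ENNReal.ofReal (|‖x‖ ^ 2 / d - 1| ^ q) ∂(stdGaussian (Vec d))
      ≤ ENNReal.ofReal (2 * (Real.exp 4 * √(q / d)) ^ q) := by
  have hd' : (0 : ℝ) < d := by exact_mod_cast hd
  have h := lintegral_abs_div_rpow_le (P := stdGaussian (Vec d)) (u := fun x => ‖x‖ ^ 2 - d)
    (by fun_prop) hd' hq ?_
  · simpa only [sub_div, div_self hd'.ne'] using h
  intro μ hμ
  have hμ4 : |μ| ≤ 1 / 4 := hμ ▸ sqrt_div_le_quarter hd' hqd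
  have h1 : ∀ x : Vec d, ENNReal.ofReal (Real.exp (μ * (‖x‖ ^ 2 - d)))
      = ENNReal.ofReal (Real.exp (-(μ * d))) * ENNReal.ofReal (Real.exp (μ * ‖x‖ ^ 2)) := by
    intro x
    rw [← ENNReal.ofReal_mul (Real.exp_pos _).le, ← Real.exp_add]
    congr 2; ring
  simp_rw [h1]
  rw [lintegral_const_mul _ (by fun_prop)]
  refine (mul_le_mul_right (lintegral_exp_mul_norm_sq_le hμ4) _).trans (le_of_eq ?_)
  rw [← ENNReal.ofReal_mul (Real.exp_pos _).le, ← Real.exp_add]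
  congr 2; ring

lemma lintegral_abs_inner_div_rpow_le {d : ℕ} (hd : 0 < d) {q : ℝ} (hq : 0 < q)
    (hqd : 16 * q ≤ d) :
    ∫⁻ z : Vec d × Vec d, ENNReal.ofReal (|⟪z.1, z.2⟫ / d| ^ q)
        ∂((stdGaussian (Vec d)).prod (stdGaussian (Vec d)))
      ≤ ENNReal.ofReal (2 * (Real.exp 4 * √(q / d)) ^ q) := by
  have hd' : (0 : ℝ) < d := by exact_mod_cast hd
  refine lintegral_abs_div_rpow_le (u := fun z : Vec d × Vec d => ⟪z.1, z.2⟫)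
    (by fun_prop) hd' hq ?_
  intro μ hμ
  have hμ4 : |μ| ≤ 1 / 4 := hμ ▸ sqrt_div_le_quarter hd' hqd
  have hμ2 : μ ^ 2 ≤ 1 / 16 := by rw [← sq_abs]; nlinarith [abs_nonneg μ]
  rw [lintegral_prod _ (by fun_prop)]
  simp_rw [lintegral_exp_mul_inner]
  refine (lintegral_exp_mul_norm_sq_le ?_).trans (ENNReal.ofReal_le_ofReal ?_)
  · rw [abs_of_nonneg (by positivity)]; linarith
  · rw [Real.exp_le_exp]
    have : 0 ≤ μ ^ 2 * d := by positivity
    nlinarith [mul_le_mul_of_nonneg_right hμ2 this]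

end Moments

section Threshold

open scoped RealInnerProductSpace

lemma measurable_stdCdf : Measurable stdCdf := monotone_stdCdf.measurable

lemma abs_stdCdf_div_sub_le {w : ℝ} (hw : 0 < w) (t : ℝ) :
    |stdCdf (t / w) - stdCdf t| ≤ 2 * |w ^ 2 - 1| := by
  rcases le_total w 1 with h | h
  · rw [abs_of_nonpos (by nlinarith : w ^ 2 - 1 ≤ 0)]
    rcases le_total w (1 / 2) with h2 | h2
    · have := abs_stdCdf_sub_le_one (t / w) t
      nlinarith
    · have h3 := abs_stdCdf_mul_sub_le (c := 1 / w) (by rw [le_div_iff₀ hw]; linarith) t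
      have h4 : 1 / w - 1 ≤ 2 * (1 - w) := by
        rw [sub_le_iff_le_add, div_le_iff₀ hw]; nlinarith
      rw [show 1 / w * t = t / w by ring] at h3
      nlinarith
  · rw [abs_of_nonneg (by nlinarith : 0 ≤ w ^ 2 - 1)]
    have h3 := abs_stdCdf_mul_sub_le h (t / w)
    rw [mul_div_cancel₀ t hw.ne', abs_sub_comm] at h3
    nlinarith

lemma integral_centredStep_inner {d : ℕ} (hd : 0 < d) (p t : ℝ) {y : Vec d} (hy : y ≠ 0) :
    ∫ x, centredStep p t (⟪y, x⟫ / √d) ∂(stdGaussian (Vec d))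
      = stdCdf (t / (‖y‖ / √d)) - p := by
  have hd' : (0 : ℝ) < d := by exact_mod_cast hd
  have h := IsGaussian.map_eq_gaussianReal (μ := stdGaussian (Vec d))
    (innerSL ℝ ((√d)⁻¹ • y))
  rw [integral_strongDual_stdGaussian, variance_dual_stdGaussian, innerSL_apply_norm, norm_smul,
    norm_inv, Real.norm_of_nonneg (Real.sqrt_nonneg _)] at h
  have hw : 0 < (√d)⁻¹ * ‖y‖ := by positivity
  rw [integral_centredStep (by fun_prop), div_eq_inv_mul ‖y‖, ← gaussianReal_real_Iic hw, ← h,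
    map_measureReal_apply (by fun_prop) measurableSet_Iic]
  congr 2
  ext x
  simp [div_eq_inv_mul]

lemma stdGaussian_ae_ne_zero {d : ℕ} (hd : 0 < d) : ∀ᵐ y ∂(stdGaussian (Vec d)), y ≠ 0 := by
  let e : Vec d := EuclideanSpace.single ⟨0, hd⟩ 1
  have he : e ≠ 0 := by simp [e]
  rw [ae_iff]
  refine measure_mono_null ?_ (stdGaussian_hyperplane he 0)
  intro x hx
  simp_all

/-- The normal distribution function at the threshold is `p` up to `O(d^{-1/2})`. -/
theorem abs_stdCdf_threshold_sub_le {d : ℕ} (hd : 0 < d) {p : ℝ} (hp0 : 0 < p) (hp1 : p < 1) :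
    |stdCdf (threshold d p) - p| ≤ 4 * Real.exp 4 / √d := by
  have hd' : (0 : ℝ) < d := by exact_mod_cast hd
  have he : (1 : ℝ) ≤ Real.exp 4 := Real.one_le_exp (by norm_num)
  set τ := threshold d p with hτ
  rcases lt_or_ge d 16 with h16 | h16
  · have h1 : √d ≤ 4 := by
      rw [Real.sqrt_le_left (by norm_num)]
      have : (d : ℝ) < 16 := by exact_mod_cast h16
      linarith
    have h2 : 1 ≤ 4 * Real.exp 4 / √d := by
      rw [le_div_iff₀ (by positivity)]; linarith
    refine le_trans ?_ h2
    rw [abs_le]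
    constructor <;> linarith [stdCdf_nonneg τ, stdCdf_le_one τ]
  set γ := stdGaussian (Vec d) with hγ
  have hF : Measurable fun z : Vec d × Vec d => ⟪z.1, z.2⟫ / √(d : ℝ) := by fun_prop
  have h0 : ∫ z : Vec d × Vec d, centredStep p τ (⟪z.1, z.2⟫ / √d) ∂(γ.prod γ) = 0 := by
    rw [integral_centredStep hF, ← map_measureReal_apply hF measurableSet_Iic]
    exact sub_eq_zero.2 (innerLaw_Iic_threshold hd hp0 hp1)
  rw [integral_prod] at h0
  swap
  · exact Integrable.of_bound ((measurable_centredStep p τ).comp hF).aestronglyMeasurable 1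
      (ae_of_all _ fun z => abs_centredStep_le_one hp0.le hp1.le _ _)
  have hint : Integrable (fun y : Vec d => stdCdf (τ / (‖y‖ / √d))) γ :=
    Integrable.of_bound (measurable_stdCdf.comp (by fun_prop)).aestronglyMeasurable 1
      (ae_of_all _ fun y => by
        rw [Real.norm_of_nonneg (stdCdf_nonneg _)]; exact stdCdf_le_one _)
  have h1 : ∫ y : Vec d, (stdCdf (τ / (‖y‖ / √d)) - p) ∂γ = 0 := by
    rw [← h0]
    refine integral_congr_ae ?_
    filter_upwards [stdGaussian_ae_ne_zero hd] with y hy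
    exact (integral_centredStep_inner hd p τ hy).symm
  have h2 : p - stdCdf τ = ∫ y : Vec d, (stdCdf (τ / (‖y‖ / √d)) - stdCdf τ) ∂γ := by
    rw [integral_sub hint (integrable_const _)] at h1 ⊢
    simp at h1 ⊢
    linarith
  rw [abs_sub_comm, h2, ← ENNReal.ofReal_le_ofReal_iff (by positivity), ← Real.norm_eq_abs,
    ofReal_norm]
  calc ‖∫ y : Vec d, (stdCdf (τ / (‖y‖ / √d)) - stdCdf τ) ∂γ‖ₑ
      ≤ ∫⁻ y : Vec d, ‖stdCdf (τ / (‖y‖ / √d)) - stdCdf τ‖ₑ ∂γ := enorm_integral_le_lintegral_enorm _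
    _ ≤ ∫⁻ y : Vec d, ENNReal.ofReal 2 * ENNReal.ofReal (|‖y‖ ^ 2 / d - 1| ^ (1 : ℝ)) ∂γ := by
        refine lintegral_mono_ae ?_
        filter_upwards [stdGaussian_ae_ne_zero hd] with y hy
        rw [← ENNReal.ofReal_mul (by norm_num), ← ofReal_norm, Real.rpow_one,
          Real.norm_eq_abs]
        refine ENNReal.ofReal_le_ofReal ?_
        have h3 := abs_stdCdf_div_sub_le (w := ‖y‖ / √d) (by positivity) τ
        rwa [div_pow, Real.sq_sqrt hd'.le] at h3
    _ ≤ ENNReal.ofReal 2 * ENNReal.ofReal (2 * (Real.exp 4 * √(1 / d)) ^ (1 : ℝ)) := by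
        rw [lintegral_const_mul _ (by fun_prop)]
        gcongr
        exact lintegral_abs_norm_sq_div_sub_one_rpow_le hd one_pos
          (by rw [mul_one]; exact_mod_cast h16)
    _ = ENNReal.ofReal (4 * Real.exp 4 / √d) := by
        rw [← ENNReal.ofReal_mul (by norm_num), Real.rpow_one, Real.sqrt_div zero_le_one,
          Real.sqrt_one]
        congr 1; ring

end Threshold

section Subgraphs

open scoped RealInnerProductSpace

variable {d n m : ℕ}

/-- The neighbourhood in `L` of a vertex of `R`. -/
def neighbours (α : Finset (Fin n × Fin m)) (u : Fin n) : Finset (Fin m) :=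
  Finset.univ.filter fun v => (u, v) ∈ α

lemma prod_edges {M : Type*} [CommMonoid M] (α : Finset (Fin n × Fin m))
    (f : Fin n × Fin m → M) : ∏ e ∈ α, f e = ∏ u, ∏ v ∈ neighbours α u, f (u, v) :=
  Finset.prod_finset_product α Finset.univ (neighbours α) (by simp [neighbours])

lemma sum_card_neighbours (α : Finset (Fin n × Fin m)) :
    ∑ u, (neighbours α u).card = α.card := by
  have h := Finset.sum_finset_product α Finset.univ (neighbours α) (by simp [neighbours])
    (f := fun _ => 1)
  simpa using h.symm

lemma edgeIndicator_sub_eq (p : ℝ) (x y : Vec d) :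
    edgeIndicator d p x y - p = centredStep p (threshold d p) (⟪x, y⟫ / √d) := by
  classical
  simp [edgeIndicator, centredStep, indicator_apply]

lemma signedWeight_eq (p : ℝ) (α : Finset (Fin n × Fin m)) (XR : Fin n → Vec d)
    (XL : Fin m → Vec d) :
    signedWeight p α XR XL =
      ∏ e ∈ α, centredStep p (threshold d p) (⟪XR e.1, XL e.2⟫ / √d) := by
  simp only [signedWeight, edgeIndicator_sub_eq]

lemma measurable_signedWeight (p : ℝ) (α : Finset (Fin n × Fin m)) :
    Measurable fun X : (Fin n → Vec d) × (Fin m → Vec d) => signedWeight p α X.1 X.2 := by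
  simp only [signedWeight_eq]
  fun_prop

lemma abs_signedWeight_le_one {p : ℝ} (hp0 : 0 ≤ p) (hp1 : p ≤ 1) (α : Finset (Fin n × Fin m))
    (XR : Fin n → Vec d) (XL : Fin m → Vec d) : |signedWeight p α XR XL| ≤ 1 := by
  rw [signedWeight_eq]
  exact abs_prod_centredStep_le_one hp0 hp1 _ α _

instance isProbabilityMeasure_latentLaw : IsProbabilityMeasure (latentLaw d n m) := by
  unfold latentLaw; infer_instance

lemma expectedSignedWeight_le_one {p : ℝ} (hp0 : 0 ≤ p) (hp1 : p ≤ 1)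
    (α : Finset (Fin n × Fin m)) : expectedSignedWeight d p α ≤ 1 := by
  have h := norm_integral_le_of_norm_le_const (μ := latentLaw d n m) (C := 1)
    (f := fun X => signedWeight p α X.1 X.2)
    (ae_of_all _ fun X => abs_signedWeight_le_one hp0 hp1 α X.1 X.2)
  rw [probReal_univ, mul_one] at h
  exact (le_abs_self _).trans h

/-- The mean over `x_u` of the factors of the signed weight at the vertex `u`. -/
noncomputable def vertexFactor (p : ℝ) (α : Finset (Fin n × Fin m)) (XL : Fin m → Vec d)
    (u : Fin n) : ℝ :=
  ∫ x, ∏ v ∈ neighbours α u, centredStep p (threshold d p) (⟪x, XL v⟫ / √d)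
    ∂(stdGaussian (Vec d))

lemma expectedSignedWeight_eq {p : ℝ} (hp0 : 0 ≤ p) (hp1 : p ≤ 1) (α : Finset (Fin n × Fin m)) :
    expectedSignedWeight d p α = ∫ XL : Fin m → Vec d, ∏ u, vertexFactor p α XL u
      ∂(Measure.pi fun _ => stdGaussian (Vec d)) := by
  rw [expectedSignedWeight, latentLaw, integral_prod_symm]
  · refine integral_congr_ae (ae_of_all _ fun XL => ?_)
    simp only [signedWeight_eq, prod_edges]
    rw [integral_fintype_prod_eq_prod (fun u x => ∏ v ∈ neighbours α u,
      centredStep p (threshold d p) (⟪x, XL v⟫ / √d))]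
    rfl
  · exact Integrable.of_bound (measurable_signedWeight p α).aestronglyMeasurable 1
      (ae_of_all _ fun X => abs_signedWeight_le_one hp0 hp1 α X.1 X.2)

/-- The deviation of the normalised Gram matrix of the latent vectors from the identity. -/
noncomputable def gramDev (X : Fin m → Vec d) (v w : Fin m) : ℝ :=
  ⟪X v, X w⟫ / d - if v = w then 1 else 0

lemma lintegral_abs_gramDev_rpow_le (hd : 0 < d) {q : ℝ} (hq : 0 < q) (hqd : 16 * q ≤ d)
    (v w : Fin m) :
    ∫⁻ X, ENNReal.ofReal (|gramDev X v w| ^ q) ∂(Measure.pi fun _ : Fin m => stdGaussian (Vec d))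
      ≤ ENNReal.ofReal (2 * (Real.exp 4 * √(q / d)) ^ q) := by
  by_cases hvw : v = w
  · subst hvw
    simp only [gramDev, if_true, real_inner_self_eq_norm_sq]
    rw [(measurePreserving_eval (fun _ : Fin m => stdGaussian (Vec d)) v).lintegral_comp
      (f := fun x : Vec d => ENNReal.ofReal (|‖x‖ ^ 2 / d - 1| ^ q)) (by fun_prop)]
    exact lintegral_abs_norm_sq_div_sub_one_rpow_le hd hq hqd
  · have hmp : MeasurePreserving (fun X : Fin m → Vec d => (X v, X w))
        (Measure.pi fun _ : Fin m => stdGaussian (Vec d))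
        ((stdGaussian (Vec d)).prod (stdGaussian (Vec d))) := by
      refine ⟨by fun_prop, ?_⟩
      have hi : iIndepFun (fun (i : Fin m) (X : Fin m → Vec d) => X i)
          (Measure.pi fun _ : Fin m => stdGaussian (Vec d)) :=
        iIndepFun_pi (X := fun _ x => x) fun _ => aemeasurable_id
      have h2 := (indepFun_iff_map_prod_eq_prod_map_map (measurable_pi_apply v).aemeasurable
        (measurable_pi_apply w).aemeasurable).1 (hi.indepFun hvw)
      rw [h2]
      congr 1
      · exact (measurePreserving_eval (fun _ : Fin m => stdGaussian (Vec d)) v).map_eq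
      · exact (measurePreserving_eval (fun _ : Fin m => stdGaussian (Vec d)) w).map_eq
    simp only [gramDev, hvw, if_false, sub_zero]
    rw [hmp.lintegral_comp (f := fun z : Vec d × Vec d => ENNReal.ofReal (|⟪z.1, z.2⟫ / d| ^ q))
      (by fun_prop)]
    exact lintegral_abs_inner_div_rpow_le hd hq hqd

/-- The constant per edge in the bound for the conditional mean of the signed weight. -/
noncomputable def edgeConst : ℝ := 2 * Real.exp 4 * (4 * Real.exp 4 + 2)

lemma two_le_edgeConst : 2 ≤ edgeConst := by
  have he : (1 : ℝ) ≤ Real.exp 4 := Real.one_le_exp (by norm_num)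
  rw [edgeConst]; nlinarith

lemma abs_vertexFactor_le (hd : 0 < d) {p : ℝ} (hp0 : 0 < p) (hp1 : p < 1)
    (α : Finset (Fin n × Fin m)) (X : Fin m → Vec d) (u : Fin n) {M η : ℝ}
    (hM : ∀ v ∈ neighbours α u, ∀ w ∈ neighbours α u, |gramDev X v w| ≤ M)
    (hη : (neighbours α u).card * M ≤ η) (hdη : 1 / d ≤ η) :
    |vertexFactor p α X u| ≤ (edgeConst * √η) ^ (neighbours α u).card := by
  have hd' : (0 : ℝ) < d := by exact_mod_cast hd
  have hη0 : 0 < η := lt_of_lt_of_le (by positivity) hdη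
  rcases le_or_gt η (1 / 2) with h | h
  · let y : neighbours α u → Vec d := fun v => (√d)⁻¹ • X v
    have h1 : vertexFactor p α X u
        = ∫ x, ∏ i, centredStep p (threshold d p) ⟪y i, x⟫ ∂(stdGaussian (Vec d)) := by
      refine integral_congr_ae (ae_of_all _ fun x => ?_)
      simp only
      rw [← Finset.prod_coe_sort]
      refine Finset.prod_congr rfl fun v _ => ?_
      simp only [y]
      rw [real_inner_smul_left, real_inner_comm, div_eq_inv_mul]
    rw [h1]
    have h2 := abs_integral_prod_centredStep_le (y := y) (p := p) (t := threshold d p) (M := M)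
      (K := 4 * Real.exp 4) hp0.le hp1.le (by positivity) hη0 h ?_ (by simpa using hη) ?_
    · simpa [edgeConst] using h2
    · intro v w
      have h3 := hM v v.2 w w.2
      have h4 : ⟪y v, y w⟫ = ⟪X v, X w⟫ / d := by
        simp only [y]
        rw [real_inner_smul_left, real_inner_smul_right, ← mul_assoc, ← mul_inv,
          Real.mul_self_sqrt hd'.le, div_eq_inv_mul]
      rw [h4]
      simpa only [gramDev, Subtype.coe_inj] using h3
    · refine (abs_stdCdf_threshold_sub_le hd hp0 hp1).trans ?_
      rw [div_eq_mul_inv, ← Real.sqrt_inv, ← one_div]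
      gcongr
  · have h1 : |vertexFactor p α X u| ≤ 1 := by
      have := norm_integral_le_of_norm_le_const (μ := stdGaussian (Vec d)) (C := 1)
        (f := fun x => ∏ v ∈ neighbours α u, centredStep p (threshold d p) (⟪x, X v⟫ / √d))
        (ae_of_all _ fun x => abs_prod_centredStep_le_one hp0.le hp1.le (threshold d p)
          (neighbours α u) (fun v => ⟪x, X v⟫ / √d))
      rwa [probReal_univ, mul_one] at this
    refine h1.trans (one_le_pow₀ ?_)
    have h2 : 1 / 2 ≤ √η := Real.le_sqrt_of_sq_le (by linarith)
    nlinarith [two_le_edgeConst]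

lemma abs_prod_vertexFactor_le (hd : 0 < d) {p : ℝ} (hp0 : 0 < p) (hp1 : p < 1)
    {α : Finset (Fin n × Fin m)} (hα : α.Nonempty) (X : Fin m → Vec d) :
    |∏ u, vertexFactor p α X u| ≤
      (edgeConst ^ 2 * α.card) ^ ((α.card : ℝ) / 2) * ((1 / d) ^ ((α.card : ℝ) / 2) +
        ∑ e ∈ α.image Prod.snd ×ˢ α.image Prod.snd, |gramDev X e.1 e.2| ^ ((α.card : ℝ) / 2)) := by
  have hd' : (0 : ℝ) < d := by exact_mod_cast hd
  set k := α.card with hk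
  have hk1 : 1 ≤ k := hα.card_pos
  have hk1' : (1 : ℝ) ≤ k := by exact_mod_cast hk1
  set V := α.image Prod.snd with hV
  have hVne : (V ×ˢ V).Nonempty := (hα.image _).product (hα.image _)
  obtain ⟨e, heV, he⟩ := Finset.exists_max_image (V ×ˢ V) (fun e => |gramDev X e.1 e.2|) hVne
  set M := max (1 / (d : ℝ)) |gramDev X e.1 e.2| with hMdef
  have hM0 : 0 < M := lt_max_of_lt_left (by positivity)
  have hc0 : 0 ≤ edgeConst := by linarith [two_le_edgeConst]
  have hnb : ∀ u, ∀ v ∈ neighbours α u, v ∈ V := fun u v hv => by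
    rw [hV, Finset.mem_image]
    exact ⟨(u, v), by simpa [neighbours] using hv, rfl⟩
  have h1 : ∀ u, |vertexFactor p α X u| ≤ (edgeConst * √(k * M)) ^ (neighbours α u).card := by
    intro u
    refine abs_vertexFactor_le (M := M) hd hp0 hp1 α X u (fun v hv w hw => ?_) ?_ ?_
    · exact (he (v, w) (Finset.mk_mem_product (hnb u v hv) (hnb u w hw))).trans (le_max_right _ _)
    · gcongr
      rw [hk, ← sum_card_neighbours]
      exact Finset.single_le_sum (f := fun u => (neighbours α u).card) (fun _ _ => Nat.zero_le _)
        (Finset.mem_univ u)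
    · exact (le_max_left _ _).trans (le_mul_of_one_le_left hM0.le hk1')
  rw [Finset.abs_prod]
  refine (Finset.prod_le_prod (fun _ _ => abs_nonneg _) fun u _ => h1 u).trans ?_
  rw [Finset.prod_pow_eq_pow_sum, sum_card_neighbours, ← hk]
  have h2 : (edgeConst * √(k * M)) ^ k
      = (edgeConst ^ 2 * k) ^ ((k : ℝ) / 2) * M ^ ((k : ℝ) / 2) := by
    have h3 : edgeConst * √(k * M) = √(edgeConst ^ 2 * k * M) := by
      rw [mul_assoc, Real.sqrt_mul (sq_nonneg _), Real.sqrt_sq hc0]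
    rw [← Real.mul_rpow (by positivity) hM0.le, h3, Real.sqrt_eq_rpow, ← Real.rpow_natCast,
      ← Real.rpow_mul (by positivity)]
    congr 1; ring
  rw [h2]
  refine mul_le_mul_of_nonneg_left ?_ (by positivity)
  have hs : ∀ i ∈ V ×ˢ V, 0 ≤ |gramDev X i.1 i.2| ^ ((k : ℝ) / 2) := fun _ _ => by positivity
  rcases max_choice (1 / (d : ℝ)) |gramDev X e.1 e.2| with h | h
  · rw [hMdef, h]
    exact le_add_of_nonneg_right (Finset.sum_nonneg hs)
  · rw [hMdef, h]
    exact le_add_of_nonneg_of_le (by positivity)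
      (Finset.single_le_sum (f := fun e : Fin m × Fin m => |gramDev X e.1 e.2| ^ ((k : ℝ) / 2))
        hs heV)

lemma measurable_gramDev (v w : Fin m) : Measurable fun X : Fin m → Vec d => gramDev X v w := by
  unfold gramDev; fun_prop

lemma expectedSignedWeight_le (hd : 0 < d) {p : ℝ} (hp0 : 0 < p) (hp1 : p < 1)
    {α : Finset (Fin n × Fin m)} (hα : α.Nonempty) (hαd : 8 * α.card ≤ d) :
    expectedSignedWeight d p α ≤
      (edgeConst ^ 2 * α.card) ^ ((α.card : ℝ) / 2) * ((1 / d) ^ ((α.card : ℝ) / 2) +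
        (α.card : ℝ) ^ 2 *
          (2 * (Real.exp 4 * √((α.card : ℝ) / 2 / d)) ^ ((α.card : ℝ) / 2))) := by
  set k := α.card with hk
  have hk1' : (1 : ℝ) ≤ k := by exact_mod_cast hα.card_pos
  set q : ℝ := (k : ℝ) / 2 with hq
  have hq0 : 0 < q := by positivity
  set A := (edgeConst ^ 2 * k) ^ q with hA
  have hA0 : 0 ≤ A := by positivity
  set V := α.image Prod.snd with hV
  set π := Measure.pi fun _ : Fin m => stdGaussian (Vec d) with hπ
  set B := 2 * (Real.exp 4 * √(q / d)) ^ q with hB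
  have hB0 : 0 ≤ B := by positivity
  have hVk : ((V ×ˢ V).card : ℝ) ≤ (k : ℝ) ^ 2 := by
    rw [Finset.card_product, sq]
    have : V.card ≤ k := Finset.card_image_le
    exact_mod_cast Nat.mul_le_mul this this
  have hm : ∀ e : Fin m × Fin m, Measurable fun X : Fin m → Vec d =>
      ENNReal.ofReal (|gramDev X e.1 e.2| ^ q) := fun e =>
    (((measurable_gramDev e.1 e.2).norm).pow_const q).ennreal_ofReal
  rw [expectedSignedWeight_eq hp0.le hp1.le]
  refine (le_abs_self _).trans ?_
  rw [← ENNReal.ofReal_le_ofReal_iff (by positivity), ← Real.norm_eq_abs, ofReal_norm]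
  calc ‖∫ X, ∏ u, vertexFactor p α X u ∂π‖ₑ
      ≤ ∫⁻ X, ‖∏ u, vertexFactor p α X u‖ₑ ∂π := enorm_integral_le_lintegral_enorm _
    _ ≤ ∫⁻ X, ENNReal.ofReal A * (ENNReal.ofReal ((1 / d) ^ q) +
          ∑ e ∈ V ×ˢ V, ENNReal.ofReal (|gramDev X e.1 e.2| ^ q)) ∂π := by
        refine lintegral_mono fun X => ?_
        rw [← ENNReal.ofReal_sum_of_nonneg fun _ _ => by positivity,
          ← ENNReal.ofReal_add (by positivity) (Finset.sum_nonneg fun _ _ => by positivity),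
          ← ENNReal.ofReal_mul hA0, ← ofReal_norm, Real.norm_eq_abs]
        exact ENNReal.ofReal_le_ofReal (abs_prod_vertexFactor_le hd hp0 hp1 hα X)
    _ = ENNReal.ofReal A * (ENNReal.ofReal ((1 / d) ^ q) +
          ∑ e ∈ V ×ˢ V, ∫⁻ X, ENNReal.ofReal (|gramDev X e.1 e.2| ^ q) ∂π) := by
        have hms : Measurable fun X => ENNReal.ofReal ((1 / (d : ℝ)) ^ q) +
            ∑ e ∈ V ×ˢ V, ENNReal.ofReal (|gramDev X e.1 e.2| ^ q) :=
          measurable_const.add (Finset.measurable_fun_sum _ fun e _ => hm e)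
        rw [lintegral_const_mul _ hms,
          lintegral_add_left measurable_const, lintegral_finsetSum _ fun e _ => hm e]
        simp
    _ ≤ ENNReal.ofReal A * (ENNReal.ofReal ((1 / d) ^ q) + ∑ e ∈ V ×ˢ V, ENNReal.ofReal B) := by
        gcongr with e
        refine lintegral_abs_gramDev_rpow_le hd hq0 ?_ _ _
        have : (8 : ℝ) * k ≤ d := by exact_mod_cast hαd
        rw [hq]; linarith
    _ = ENNReal.ofReal (A * ((1 / d) ^ q + (V ×ˢ V).card * B)) := by
        rw [← ENNReal.ofReal_sum_of_nonneg fun _ _ => hB0,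
          ← ENNReal.ofReal_add (by positivity) (Finset.sum_nonneg fun _ _ => hB0),
          ← ENNReal.ofReal_mul hA0]
        simp
    _ ≤ ENNReal.ofReal (A * ((1 / d) ^ q + (k : ℝ) ^ 2 * B)) := by
        refine ENNReal.ofReal_le_ofReal ?_
        gcongr

end Subgraphs

end BipartiteRGG

theorem mainTheorem4 (p : ℝ) (hp0 : 0 < p) (hp1 : p < 1) :
    ∃ C : ℝ, 0 < C ∧
      ∀ (d : ℕ), 2 ≤ d → ∀ (n m : ℕ) (α : Finset (Fin n × Fin m)),
        BipartiteRGG.expectedSignedWeight d p α ≤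
          (C * (α.card : ℝ) ^ (3 / 2 : ℝ) * Real.log (d : ℝ) ^ (1 / 2 : ℝ) / Real.sqrt (d : ℝ)) ^
            ((α.card : ℝ) / 2) := by
  have hc2 := BipartiteRGG.two_le_edgeConst
  set c := BipartiteRGG.edgeConst with hc
  have he1 : (1 : ℝ) ≤ Real.exp 12 := Real.one_le_exp (by norm_num)
  have hC4 : 4 ≤ Real.exp 12 * c ^ 2 := by nlinarith
  refine ⟨2 * (Real.exp 12 * c ^ 2), by positivity, ?_⟩
  intro d hd n m α
  rcases α.eq_empty_or_nonempty with rfl | hα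
  · simpa using BipartiteRGG.expectedSignedWeight_le_one hp0.le hp1.le _
  set k := α.card with hk
  have hk1 : (1 : ℝ) ≤ k := by exact_mod_cast hα.card_pos
  have hd' : (0 : ℝ) < d := by positivity
  have hd2 : (2 : ℝ) ≤ d := by exact_mod_cast hd
  have hlog : 1 / 2 ≤ Real.log (d : ℝ) ^ (1 / 2 : ℝ) := by
    rw [← Real.sqrt_eq_rpow]
    refine Real.le_sqrt_of_sq_le ?_
    have := Real.log_le_log (by norm_num) hd2
    linarith [Real.log_two_gt_d9]
  have hk32 : (k : ℝ) ^ (3 / 2 : ℝ) = k * √k := by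
    rw [show (3 / 2 : ℝ) = 1 + 1 / 2 by norm_num, Real.rpow_add (by positivity), Real.rpow_one,
      Real.sqrt_eq_rpow]
  have hbase : Real.exp 12 * c ^ 2 * k * (√k / √d) ≤
      2 * (Real.exp 12 * c ^ 2) * (k : ℝ) ^ (3 / 2 : ℝ) * Real.log (d : ℝ) ^ (1 / 2 : ℝ) / √d := by
    rw [hk32]
    calc Real.exp 12 * c ^ 2 * k * (√k / √d)
        = 2 * (Real.exp 12 * c ^ 2) * (k * √k) * (1 / 2) / √d := by ring
      _ ≤ _ := by gcongr
  refine le_trans ?_ (Real.rpow_le_rpow (by positivity) hbase (by positivity))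
  rcases lt_or_ge d (8 * k) with h8 | h8
  · refine (BipartiteRGG.expectedSignedWeight_le_one hp0.le hp1.le α).trans
      (Real.one_le_rpow ?_ (by positivity))
    have h1 : √(d : ℝ) ≤ 4 * √k := by
      rw [show (4 : ℝ) * √k = √(16 * k) by
        rw [Real.sqrt_mul (by norm_num), show (16 : ℝ) = 4 ^ 2 by norm_num,
          Real.sqrt_sq (by norm_num)]]
      refine Real.sqrt_le_sqrt ?_
      have : (d : ℝ) < 8 * k := by exact_mod_cast h8
      linarith
    have h2 : 1 / 4 ≤ √(k : ℝ) / √d := by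
      rw [le_div_iff₀ (by positivity)]; linarith
    have h3 : 4 ≤ Real.exp 12 * c ^ 2 * k := by nlinarith
    nlinarith
  refine (BipartiteRGG.expectedSignedWeight_le (by positivity) hp0 hp1 hα h8).trans ?_
  rw [← hc, ← hk]
  set q : ℝ := (k : ℝ) / 2 with hq
  have hq1 : 1 / 2 ≤ q := by rw [hq]; linarith
  set r := √(k : ℝ) / √d with hr
  have hr0 : 0 ≤ r := by positivity
  have hdr : 1 / (d : ℝ) ≤ Real.exp 4 * r := by
    have h1 : 1 / (d : ℝ) ≤ 1 / √d := by
      refine one_div_le_one_div_of_le (by positivity) ?_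
      rw [Real.sqrt_le_left hd'.le]; nlinarith
    have h2 : 1 / √(d : ℝ) ≤ r := by
      rw [hr]; gcongr; exact Real.one_le_sqrt.2 hk1
    have h3 : r ≤ Real.exp 4 * r :=
      le_mul_of_one_le_left hr0 (Real.one_le_exp (by norm_num))
    linarith
  have hqr : √(q / d) ≤ r := by
    rw [hr, ← Real.sqrt_div (by positivity)]
    refine Real.sqrt_le_sqrt ?_
    gcongr; rw [hq]; linarith
  have hk2 : 3 * (k : ℝ) ^ 2 ≤ Real.exp 8 ^ q := by
    have h1 : (3 : ℝ) ≤ Real.exp (2 * k) := by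
      have := Real.add_one_le_exp (2 * (k : ℝ)); linarith
    have h2 : (k : ℝ) ≤ Real.exp k := by
      have := Real.add_one_le_exp (k : ℝ); linarith
    calc 3 * (k : ℝ) ^ 2 ≤ Real.exp (2 * k) * Real.exp k ^ 2 := by gcongr
      _ = Real.exp 8 ^ q := by
        rw [← Real.exp_mul, ← Real.exp_nat_mul, ← Real.exp_add]
        congr 1; rw [hq]; push_cast; ring
  calc (c ^ 2 * k) ^ q * ((1 / d) ^ q + (k : ℝ) ^ 2 * (2 * (Real.exp 4 * √(q / d)) ^ q))
      ≤ (c ^ 2 * k) ^ q * ((k : ℝ) ^ 2 * (Real.exp 4 * r) ^ q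
          + (k : ℝ) ^ 2 * (2 * (Real.exp 4 * r) ^ q)) := by
        have hkk : 1 ≤ (k : ℝ) ^ 2 := one_le_pow₀ hk1
        have h1 : (1 / (d : ℝ)) ^ q ≤ (k : ℝ) ^ 2 * (Real.exp 4 * r) ^ q :=
          (Real.rpow_le_rpow (by positivity) hdr (by positivity)).trans
            (le_mul_of_one_le_left (by positivity) hkk)
        gcongr
    _ = (c ^ 2 * k) ^ q * (3 * (k : ℝ) ^ 2) * (Real.exp 4 * r) ^ q := by ring
    _ ≤ (c ^ 2 * k) ^ q * Real.exp 8 ^ q * (Real.exp 4 * r) ^ q := by gcongr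
    _ = (Real.exp 12 * c ^ 2 * k * r) ^ q := by
        rw [← Real.mul_rpow (by positivity) (by positivity),
          ← Real.mul_rpow (by positivity) (by positivity)]
        congr 1
        rw [show (12 : ℝ) = 8 + 4 by norm_num, Real.exp_add]
        ring
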